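/- For $J\in\{0,\tfrac12,1,\tfrac32,\dots\}$ let $U_{g,J}$ be the $(2J+1)$-dimensional irreducible unitary representation of $SU(2)$ (the double cover of the rotation group $SO(3)$), written in the eigenbasis $\{|J,m\rangle : m=-J,\dots,J\}$ of the $z$ component of the angular momentum. Let $|\Phi_J\rangle=\frac{1}{\sqrt{2J+1}}\sum_{m=-J}^{J}|J,m\rangle\otimes|J,m\rangle$ be the standard spin-$J$ Bell state, and let $|\Phi_{g,J}\rangle=(U_{g,J}\otimes I)|\Phi_J\rangle$ be the rotated Bell state; as a density operator it depends only on the rotation represented by $g$. A probabilistic machine from $N$ pairs of spin-$J$ systems to $M$ pairs of spin-$K$ systems is a quantum operation $\mathcal M$, that is, a completely positive trace-non-increasing linear map from the operators on $(\mathbb C^{2J+1}\otimes\mathbb C^{2J+1})^{\otimes N}$ to the operators on $(\mathbb C^{2K+1}\otimes\mathbb C^{2K+1})^{\otimes M}$; it does not depend on $g$ and may act jointly on all systems. With $dg$ the normalized Haar measure, its success probability is $$p_{\rm succ}(\mathcal M)=\int dg\,\operatorname{Tr}\big[\mathcal M\big((|\Phi_{g,J}\rangle\langle\Phi_{g,J}|)^{\otimes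 N}\big)\big],$$ and, when $p_{\rm succ}(\mathcal M)>0$, its fidelity (conditional on success) is $$F(\mathcal M)=\frac{\int dg\,\langle\Phi_{g,K}|^{\otimes M}\,\mathcal M\big((|\Phi_{g,J}\rangle\langle\Phi_{g,J}|)^{\otimes N}\big)\,|\Phi_{g,K}\rangle^{\otimes M}}{p_{\rm succ}(\mathcal M)} .$$ Theorem. Let $N>1$ and $M\ge 0$ be integers and let $J,K\in\{0,\tfrac12,1,\dots\}$. There is a probabilistic machine $\mathcal M$ from $N$ pairs of spin-$J$ systems to $M$ pairs of spin-$K$ systems with $p_{\rm succ}(\mathcal M)>0$ and $F(\mathcal M)=1$ if and only if $NJ\ge MK$. -/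

import Mathlib

open scoped Matrix Kronecker ComplexOrder
open MeasureTheory

noncomputable section

namespace BellConversion

/-! ### The group of rotations

A rotation acts on spin systems through its lift to `SU(2)`, which is determined up to sign. -/

/-- The group `SU(2)`, the double cover of the rotation group `SO(3)`. -/
abbrev SU2 : Type := Matrix.specialUnitaryGroup (Fin 2) ℂ

instance : IsTopologicalGroup SU2 where
  continuous_mul := by
    refine Continuous.subtype_mk ?_ _
    exact (continuous_subtype_val.comp continuous_fst).mul
      (continuous_subtype_val.comp continuous_snd)
  continuous_inv := by
    refine Continuous.subtype_mk ?_ _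
    exact continuous_star.comp continuous_subtype_val

instance : CompactSpace SU2 := by
  refine isCompact_iff_compactSpace.1 (?_ : IsCompact
    (Matrix.specialUnitaryGroup (Fin 2) ℂ : Set (Matrix (Fin 2) (Fin 2) ℂ)))
  have hb : IsCompact (Set.univ.pi fun _ : Fin 2 => Set.univ.pi fun _ : Fin 2 =>
      Metric.closedBall (0 : ℂ) 1) :=
    isCompact_univ_pi fun _ => isCompact_univ_pi fun _ => isCompact_closedBall 0 1
  refine hb.of_isClosed_subset ?_ ?_
  · have h : (Matrix.specialUnitaryGroup (Fin 2) ℂ : Set (Matrix (Fin 2) (Fin 2) ℂ)) =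
        {A | A * star A = 1} ∩ {A | A.det = 1} := by
      ext A
      simp only [SetLike.mem_coe, Matrix.mem_specialUnitaryGroup_iff,
        Matrix.mem_unitaryGroup_iff, Set.mem_inter_iff, Set.mem_ofPred_eq]
    rw [h]
    exact (isClosed_eq (continuous_id.mul continuous_star) continuous_const).inter
      (isClosed_eq continuous_id.matrix_det continuous_const)
  · intro A hA i _ j _
    rw [mem_closedBall_zero_iff]
    exact entry_norm_bound_of_unitary (Matrix.mem_specialUnitaryGroup_iff.1 hA).1 i j

instance : MeasurableSpace SU2 := borel SU2

instance : BorelSpace SU2 := ⟨rfl⟩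

/-- The normalized Haar measure of `SU(2)`. Its image in `SO(3)` is the normalized Haar measure. -/
def haarSU2 : Measure SU2 := Measure.haarMeasure ⊤

/-! ### Spin systems and rotated Bell states -/

/-- A spin `J ∈ {0, 1/2, 1, 3/2, …}`, given by the natural number `2J`. -/
structure Spin where
  /-- The number `2J`. -/
  twice : ℕ

/-- The quantum number `J`. -/
def Spin.val (J : Spin) : ℝ := (J.twice : ℝ) / 2

/-- The dimension `2J + 1` of a spin-`J` system. -/
abbrev Spin.dim (J : Spin) : ℕ := J.twice + 1

/-- The matrix `U_{g,J}` of the irreducible spin-`J` representation of `SU(2)`, in the basis of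
eigenvectors of the `z` component of the angular momentum. The index `l = 0, …, 2J` stands for
`|J, m⟩` with `m = J - l`, realized as the normalized binary form
`√(choose (2J) l) x^(2J-l) y^l`, on which `g` acts by the substitution
`x ↦ g₀₀ x + g₁₀ y`, `y ↦ g₀₁ x + g₁₁ y` (below `x = 1` and `y` is the polynomial variable). -/
def spinMatrix (J : Spin) (g : SU2) : Matrix (Fin J.dim) (Fin J.dim) ℂ :=
  Matrix.of fun k l =>
    ((Real.sqrt (J.twice.choose l) / Real.sqrt (J.twice.choose k) : ℝ) : ℂ) *
      (((Polynomial.C (g.1 0 0) + Polynomial.C (g.1 1 0) * Polynomial.X) ^ (J.twice - (l : ℕ)) *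
        (Polynomial.C (g.1 0 1) + Polynomial.C (g.1 1 1) * Polynomial.X) ^ (l : ℕ)).coeff k)

/-- The standard Bell state `|Φ_J⟩ = (∑ m, |J,m⟩ ⊗ |J,m⟩) / √(2J+1)`. -/
def bell (J : Spin) : Fin J.dim × Fin J.dim → ℂ :=
  fun p => if p.1 = p.2 then ((1 / Real.sqrt J.dim : ℝ) : ℂ) else 0

/-- The rotated Bell state `|Φ_{g,J}⟩ = (U_{g,J} ⊗ I) |Φ_J⟩`. -/
def rotatedBell (J : Spin) (g : SU2) : Fin J.dim × Fin J.dim → ℂ :=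
  (spinMatrix J g ⊗ₖ (1 : Matrix (Fin J.dim) (Fin J.dim) ℂ)) *ᵥ bell J

/-- Index set of the product basis of `N` pairs of spin-`J` systems. -/
abbrev Pairs (N : ℕ) (J : Spin) : Type := Fin N → Fin J.dim × Fin J.dim

/-- The `N`-copy state `|Φ_{g,J}⟩^{⊗N}`. -/
def copies (N : ℕ) (J : Spin) (g : SU2) : Pairs N J → ℂ :=
  fun i => ∏ n, rotatedBell J g (i n)

/-- The density matrix `|ψ⟩⟨ψ|`. -/
def pureState {α : Type} (ψ : α → ℂ) : Matrix α α ℂ := Matrix.vecMulVec ψ (star ψ)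

/-! ### Probabilistic machines -/

/-- The map `id_k ⊗ Φ` on `k × k` block matrices: `Φ` is applied to every block. -/
def ampliation {α β : Type} (k : ℕ) (Φ : Matrix α α ℂ →ₗ[ℂ] Matrix β β ℂ)
    (X : Matrix (Fin k × α) (Fin k × α) ℂ) : Matrix (Fin k × β) (Fin k × β) ℂ :=
  Matrix.of fun p q => Φ (Matrix.of fun a b => X (p.1, a) (q.1, b)) p.2 q.2

/-- A linear map between matrix algebras is completely positive if all its ampliations preserve
positive semidefiniteness. -/
def CompletelyPositive {α β : Type} (Φ : Matrix α α ℂ →ₗ[ℂ] Matrix β β ℂ) : Prop :=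
  ∀ (k : ℕ) (X : Matrix (Fin k × α) (Fin k × α) ℂ), X.PosSemidef → (ampliation k Φ X).PosSemidef

/-- A quantum operation: a completely positive trace-non-increasing linear map. -/
structure QuantumOperation (α β : Type) [Fintype α] [Fintype β] where
  /-- The underlying linear map. -/
  toMap : Matrix α α ℂ →ₗ[ℂ] Matrix β β ℂ
  completelyPositive : CompletelyPositive toMap
  trace_le : ∀ ρ : Matrix α α ℂ, ρ.PosSemidef → (toMap ρ).trace.re ≤ ρ.trace.re

variable {N M : ℕ} {J K : Spin}

/-- The probability of success `p(succ|g)` when the input is `|Φ_{g,J}⟩^{⊗N}`. -/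
def successProbAt (𝓜 : QuantumOperation (Pairs N J) (Pairs M K)) (g : SU2) : ℝ :=
  (𝓜.toMap (pureState (copies N J g))).trace.re

/-- The total success probability, averaged over the rotations. -/
def successProb (𝓜 : QuantumOperation (Pairs N J) (Pairs M K)) : ℝ :=
  ∫ g, successProbAt 𝓜 g ∂haarSU2

/-- The unnormalized overlap `⟨Φ_{g,K}|^{⊗M} 𝓜(|Φ_{g,J}⟩⟨Φ_{g,J}|^{⊗N}) |Φ_{g,K}⟩^{⊗M}`. -/
def overlapAt (𝓜 : QuantumOperation (Pairs N J) (Pairs M K)) (g : SU2) : ℝ :=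
  (star (copies M K g) ⬝ᵥ (𝓜.toMap (pureState (copies N J g)) *ᵥ copies M K g)).re

/-- The fidelity of the probabilistic conversion `|Φ_{g,J}⟩^{⊗N} → |Φ_{g,K}⟩^{⊗M}` performed by
`𝓜`: the average fidelity conditional on success (meaningful when `successProb 𝓜 ≠ 0`). -/
def fidelity (𝓜 : QuantumOperation (Pairs N J) (Pairs M K)) : ℝ :=
  (∫ g, overlapAt 𝓜 g ∂haarSU2) / successProb 𝓜

/-- The machine `𝓜` succeeds with positive probability and then converts `N` copies of the rotated
spin-`J` Bell state into `M` copies of the corresponding spin-`K` Bell state with unit fidelity. -/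
def PerfectlyConverts (𝓜 : QuantumOperation (Pairs N J) (Pairs M K)) : Prop :=
  0 < successProb 𝓜 ∧ fidelity 𝓜 = 1

end BellConversion

end

open BellConversion

open scoped Matrix Kronecker ComplexOrder
open MeasureTheory

noncomputable section

namespace BellConversion

/-! ### Products of matrix coefficients of binary forms -/

section Forms

open Polynomial Pointwise

variable {R : Type*} [CommRing R]

/-! Let `a, b, c, d` be the entries of `g`. The components of `N` copies of the rotated spin-`J`
Bell state are homogeneous polynomials of degree `2JN` in them, so the question becomes one of
comparing degrees of polynomial functions on `SU(2)`.

Sufficiency: once two copies are present, these components span all homogeneous polynomials of that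
degree (`entrySpan_pow_le_coeffSpan_pow`, `exists_coeffs`). If `MK ≤ NJ`, multiplying each target
component by `a ^ δ` with `δ = 2NJ - 2MK` raises it to the input degree. A fixed matrix `A`
therefore sends the input vector to `a ^ δ` times the target vector. Conjugation by `A`, rescaled to
be trace-non-increasing, is a perfect machine; it succeeds with probability proportional to `|a| ^
(2δ)`, which is nonzero at the identity.

Necessity: unit average fidelity forces, for every `g`, the output to be `s g` times the target
projector, where `s g` is the success probability (`apply_eq_of_re_overlap_eq_trace`). Conjugation
permutes the entries of `g` up to sign, so output entries have degree `4NJ`. The target projector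
has entries proportional to `a ^ (4MK)` and `b ^ (4MK)`. If `4MK > 4NJ`, left multiplication by the
diagonal torus gives these powers a weight too high for the output. Averaging over the torus then
kills the mean of `s ≥ 0`, and hence `s` itself (`eq_zero_of_mul_pow_mem`). -/

lemma coeff_linear_pow (a c : R) (n p : ℕ) :
    ((C a + C c * X) ^ n).coeff p = n.choose p * a ^ (n - p) * c ^ p := by
  rw [add_comm, add_pow, finsetSum_coeff]
  have h : ∀ m ∈ Finset.range (n + 1),
      ((C c * X) ^ m * C a ^ (n - m) * (n.choose m : R[X])).coeff p =
        if m = p then (n.choose p : R) * a ^ (n - p) * c ^ p else 0 := by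
    intro m _
    have e : (C c * X) ^ m * C a ^ (n - m) * (n.choose m : R[X]) =
        C (n.choose m * a ^ (n - m) * c ^ m) * X ^ m := by
      simp only [mul_pow, map_mul, map_pow, map_natCast]; ring
    rw [e, coeff_C_mul_X_pow]
    split_ifs with h1 h2 h2
    · subst h1; rfl
    · exact absurd h1.symm h2
    · exact absurd h2.symm h1
    · rfl
  rw [Finset.sum_congr rfl h, Finset.sum_ite_eq' (Finset.range (n + 1)) p]
  split_ifs with h1
  · rfl
  · rw [Nat.choose_eq_zero_of_lt (by simpa using h1)]; simp

/-- The coefficient of `X ^ k` in `(a + c X) ^ (D - l) * (b + d X) ^ l`. -/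
def formCoeff (D : ℕ) (a b c d : R) (k l : ℕ) : R :=
  ((C a + C c * X) ^ (D - l) * (C b + C d * X) ^ l).coeff k

lemma formCoeff_eq (D : ℕ) (a b c d : R) (k l : ℕ) :
    formCoeff D a b c d k l = ∑ p ∈ Finset.HasAntidiagonal.antidiagonal k,
      ((D - l).choose p.1 * a ^ (D - l - p.1) * c ^ p.1) *
        (l.choose p.2 * b ^ (l - p.2) * d ^ p.2) := by
  simp only [formCoeff, coeff_mul, coeff_linear_pow]

lemma map_formCoeff {S : Type*} [CommRing S] (f : R →+* S) (D : ℕ) (a b c d : R) (k l : ℕ) :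
    f (formCoeff D a b c d k l) = formCoeff D (f a) (f b) (f c) (f d) k l := by
  simp [formCoeff_eq]

lemma formCoeff_zero (D : ℕ) (a b c d : R) (l : ℕ) :
    formCoeff D a b c d 0 l = a ^ (D - l) * b ^ l := by
  simp [formCoeff_eq]

lemma formCoeff_swap_columns {D l : ℕ} (hl : l ≤ D) (a b c d : R) (k : ℕ) :
    formCoeff D b a d c k l = formCoeff D a b c d k (D - l) := by
  rw [formCoeff, formCoeff, mul_comm, Nat.sub_sub_self hl]

lemma reflect_linear_pow (a c : R) (n : ℕ) :
    reflect n ((C a + C c * X) ^ n) = (C c + C a * X) ^ n := by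
  ext p
  rw [coeff_reflect, coeff_linear_pow, coeff_linear_pow]
  by_cases hp : p ≤ n
  · rw [revAt_le hp, Nat.choose_symm hp, Nat.sub_sub_self hp]; ring
  · rw [revAt_eq_self_of_lt (not_le.1 hp), Nat.choose_eq_zero_of_lt (not_le.1 hp)]; simp

lemma natDegree_linear_pow_le (a c : R) (n : ℕ) : ((C a + C c * X) ^ n).natDegree ≤ n := by
  refine natDegree_pow_le_of_le n (m := 1) ?_ |>.trans (by simp)
  rw [add_comm]; exact natDegree_linear_le

/-- Exchanging the rows reverses the coefficient list of the degree `D` product of linear factors.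
-/
lemma formCoeff_swap_rows {D k l : ℕ} (hk : k ≤ D) (hl : l ≤ D) (a b c d : R) :
    formCoeff D c d a b k l = formCoeff D a b c d (D - k) l := by
  have h := reflect_mul _ _ (natDegree_linear_pow_le a c (D - l)) (natDegree_linear_pow_le b d l)
  rw [reflect_linear_pow, reflect_linear_pow, Nat.sub_add_cancel hl] at h
  rw [formCoeff, formCoeff, ← h, coeff_reflect, revAt_le hk]

lemma exists_monomial_of_mem_pow (a b c d : R) (n : ℕ) :
    ∀ x ∈ ({a, b, c, d} : Set R) ^ n,
      ∃ i j k l, i + j + k + l = n ∧ x = a ^ i * b ^ j * c ^ k * d ^ l := by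
  induction n with
  | zero => intro x hx; exact ⟨0, 0, 0, 0, rfl, by simpa using hx⟩
  | succ n ih =>
    intro x hx
    rw [pow_succ, Set.mem_mul] at hx
    obtain ⟨y, hy, z, hz, rfl⟩ := hx
    obtain ⟨i, j, k, l, h, rfl⟩ := ih y hy
    rcases hz with rfl | rfl | rfl | rfl
    · exact ⟨i + 1, j, k, l, by omega, by ring⟩
    · exact ⟨i, j + 1, k, l, by omega, by ring⟩
    · exact ⟨i, j, k + 1, l, by omega, by ring⟩
    · exact ⟨i, j, k, l + 1, by omega, by ring⟩

variable [Algebra ℂ R]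

/-- The span of the entries of the degree `D` symmetric power of the matrix `!![a, b; c, d]`. -/
def coeffSpan (D : ℕ) (a b c d : R) : Submodule ℂ R :=
  Submodule.span ℂ {x | ∃ k ≤ D, ∃ l ≤ D, formCoeff D a b c d k l = x}

lemma formCoeff_mem {D k l : ℕ} (hk : k ≤ D) (hl : l ≤ D) (a b c d : R) :
    formCoeff D a b c d k l ∈ coeffSpan D a b c d :=
  Submodule.subset_span ⟨k, hk, l, hl, rfl⟩

lemma coeffSpan_swap_columns_le (D : ℕ) (a b c d : R) :
    coeffSpan D b a d c ≤ coeffSpan D a b c d := by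
  refine Submodule.span_le.2 ?_
  rintro _ ⟨k, hk, l, hl, rfl⟩
  rw [formCoeff_swap_columns hl]
  exact formCoeff_mem hk (Nat.sub_le _ _) a b c d

lemma coeffSpan_swap_rows_le (D : ℕ) (a b c d : R) :
    coeffSpan D c d a b ≤ coeffSpan D a b c d := by
  refine Submodule.span_le.2 ?_
  rintro _ ⟨k, hk, l, hl, rfl⟩
  rw [formCoeff_swap_rows hk hl]
  exact formCoeff_mem (Nat.sub_le _ _) hl a b c d

/-- The span of the entries of the matrix `!![a, b; c, d]`. -/
def entrySpan (a b c d : R) : Submodule ℂ R := Submodule.span ℂ {a, b, c, d}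

lemma monomial_mem_entrySpan_pow (a b c d : R) (i j k l : ℕ) :
    a ^ i * b ^ j * c ^ k * d ^ l ∈ entrySpan a b c d ^ (i + j + k + l) := by
  have h : ∀ x ∈ ({a, b, c, d} : Set R), ∀ n : ℕ, x ^ n ∈ entrySpan a b c d ^ n :=
    fun x hx n => Submodule.pow_mem_pow _ (Submodule.subset_span hx) n
  rw [pow_add, pow_add, pow_add]
  exact Submodule.mul_mem_mul (Submodule.mul_mem_mul (Submodule.mul_mem_mul
    (h a (by simp) i) (h b (by simp) j)) (h c (by simp) k)) (h d (by simp) l)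

lemma entrySpan_pow_le {n : ℕ} {a b c d : R} {P : Submodule ℂ R}
    (h : ∀ i j k l, i + j + k + l = n → a ^ i * b ^ j * c ^ k * d ^ l ∈ P) :
    entrySpan a b c d ^ n ≤ P := by
  rw [entrySpan, Submodule.span_pow, Submodule.span_le]
  intro x hx
  obtain ⟨i, j, k, l, hn, rfl⟩ := exists_monomial_of_mem_pow a b c d n x hx
  exact h i j k l hn

lemma formCoeff_mem_entrySpan_pow {D l : ℕ} (hl : l ≤ D) (a b c d : R) (k : ℕ) :
    formCoeff D a b c d k l ∈ entrySpan a b c d ^ D := by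
  rw [formCoeff_eq]
  refine Submodule.sum_mem _ fun p _ => ?_
  by_cases h1 : p.1 ≤ D - l
  · by_cases h2 : p.2 ≤ l
    · have h := monomial_mem_entrySpan_pow a b c d (D - l - p.1) (l - p.2) p.1 p.2
      rw [show D - l - p.1 + (l - p.2) + p.1 + p.2 = D by omega] at h
      convert Submodule.smul_mem _ (((D - l).choose p.1 * l.choose p.2 : ℕ) : ℂ) h using 1
      rw [Algebra.smul_def, map_natCast]; push_cast; ring
    · rw [Nat.choose_eq_zero_of_lt (not_le.1 h2)]; simp
  · rw [Nat.choose_eq_zero_of_lt (not_le.1 h1)]; simp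

lemma coeffSpan_le (D : ℕ) (a b c d : R) : coeffSpan D a b c d ≤ entrySpan a b c d ^ D := by
  refine Submodule.span_le.2 ?_
  rintro _ ⟨k, _, l, hl, rfl⟩
  exact formCoeff_mem_entrySpan_pow hl a b c d k

/-- Triangular elimination on the exponent of `d`: a suitable product of two coefficients is a
nonzero multiple of the monomial plus monomials with fewer `d`s and the same row and column degrees.
The two inequalities keep all indices within `0, …, D`. -/
lemma monomial_mem_of_heavy {D : ℕ} (a b c d : R) (l : ℕ) : ∀ i j k,
    i + j + k + l = 2 * D → D ≤ i + j → D ≤ i + k →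
      a ^ i * b ^ j * c ^ k * d ^ l ∈ coeffSpan D a b c d * coeffSpan D a b c d := by
  induction l using Nat.strong_induction_on with
  | _ l ih =>
  intro i j k hs hR hS
  -- The first factor is `a ^ (D - j) * b ^ j`; the second supplies `a ^ (D - l - k) * c ^ k * d ^
  -- l` as its term `(k, l)`.
  have hmem := Submodule.mul_mem_mul (formCoeff_mem (D := D) (Nat.zero_le _)
    (show j ≤ D by omega) a b c d)
    (formCoeff_mem (D := D) (show k + l ≤ D by omega) (show l ≤ D by omega) a b c d)
  rw [formCoeff_zero, formCoeff_eq,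
    ← Finset.add_sum_erase _ _ (Finset.HasAntidiagonal.mem_antidiagonal.2
      (rfl : (k, l).1 + (k, l).2 = k + l)),
    mul_add, Finset.mul_sum] at hmem
  have hrest : ∑ p ∈ (Finset.HasAntidiagonal.antidiagonal (k + l)).erase (k, l),
      a ^ (D - j) * b ^ j *
      (((D - l).choose p.1 * a ^ (D - l - p.1) * c ^ p.1) *
        (l.choose p.2 * b ^ (l - p.2) * d ^ p.2)) ∈
      coeffSpan D a b c d * coeffSpan D a b c d := by
    refine Submodule.sum_mem _ fun p hp => ?_
    rw [Finset.mem_erase, Finset.HasAntidiagonal.mem_antidiagonal] at hp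
    obtain ⟨hne, hp⟩ := hp
    by_cases h1 : p.1 ≤ D - l
    · by_cases h2 : p.2 ≤ l
      · have h3 : p.2 < l := by
          refine lt_of_le_of_ne h2 fun h => hne (Prod.ext ?_ h)
          change p.1 = k
          omega
        have h := ih p.2 h3 (D - j + (D - l - p.1)) (j + (l - p.2)) p.1
          (by omega) (by omega) (by omega)
        convert Submodule.smul_mem _ (((D - l).choose p.1 * l.choose p.2 : ℕ) : ℂ) h using 1
        rw [Algebra.smul_def, map_natCast, pow_add, pow_add]; push_cast; ring
      · rw [Nat.choose_eq_zero_of_lt (not_le.1 h2)]; simp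
    · rw [Nat.choose_eq_zero_of_lt (not_le.1 h1)]; simp
  have h := (Submodule.add_mem_iff_left _ hrest).1 hmem
  have hc : (((D - l).choose k : ℕ) : ℂ) ≠ 0 := by
    exact_mod_cast (Nat.choose_pos (by omega)).ne'
  rw [← Submodule.smul_mem_iff _ hc]
  convert h using 1
  rw [Algebra.smul_def, map_natCast, show i = D - j + (D - l - k) by omega, pow_add]
  simp only [Nat.choose_self, Nat.sub_self]
  push_cast; ring

/-- In degree `2D` one row and one column carry at least half of the degree; swapping rows or
columns, which preserves the coefficient span, makes them the first ones. -/
lemma entrySpan_pow_le_coeffSpan_mul (D : ℕ) (a b c d : R) :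
    entrySpan a b c d ^ (2 * D) ≤ coeffSpan D a b c d * coeffSpan D a b c d := by
  refine entrySpan_pow_le fun i j k l hs => ?_
  have hcol := coeffSpan_swap_columns_le D a b c d
  have hrow := coeffSpan_swap_rows_le D a b c d
  rcases le_total D (i + j) with hR | hR <;> rcases le_total D (i + k) with hS | hS
  · exact monomial_mem_of_heavy a b c d l i j k hs hR hS
  · have h := monomial_mem_of_heavy b a d c k j i l (D := D) (by omega) (by omega) (by omega)
    convert mul_le_mul' hcol hcol h using 1; ring
  · have h := monomial_mem_of_heavy c d a b j k l i (D := D) (by omega) (by omega) (by omega)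
    convert mul_le_mul' hrow hrow h using 1; ring
  · have h := monomial_mem_of_heavy d c b a i l k j (D := D) (by omega) (by omega) (by omega)
    have hboth := (coeffSpan_swap_columns_le D c d a b).trans hrow
    convert mul_le_mul' hboth hboth h using 1; ring

/-- At least two factors are needed: the coefficients of a single symmetric power do not span all
monomials. -/
lemma entrySpan_pow_le_coeffSpan_pow (D : ℕ) (a b c d : R) (n : ℕ) :
    entrySpan a b c d ^ (D * (n + 2)) ≤ coeffSpan D a b c d ^ (n + 2) := by
  induction n with
  | zero =>
    rw [zero_add, mul_comm, pow_two (coeffSpan D a b c d)]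
    exact entrySpan_pow_le_coeffSpan_mul D a b c d
  | succ n ih =>
    -- Split off degree `2D` as two coefficients, then put one of them back among the monomials so
    -- that the induction hypothesis applies to degree `D * (n + 2)`.
    calc entrySpan a b c d ^ (D * (n + 1 + 2))
        = entrySpan a b c d ^ (D * (n + 1)) * entrySpan a b c d ^ (2 * D) := by
          rw [← pow_add]; congr 1; ring
      _ ≤ entrySpan a b c d ^ (D * (n + 1)) * (coeffSpan D a b c d * coeffSpan D a b c d) :=
          mul_le_mul' le_rfl (entrySpan_pow_le_coeffSpan_mul D a b c d)
      _ ≤ entrySpan a b c d ^ (D * (n + 1)) * (entrySpan a b c d ^ D * coeffSpan D a b c d) :=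
          mul_le_mul' le_rfl (mul_le_mul' (coeffSpan_le D a b c d) le_rfl)
      _ = entrySpan a b c d ^ (D * (n + 2)) * coeffSpan D a b c d := by
          rw [← mul_assoc, ← pow_add]; congr 2
      _ ≤ coeffSpan D a b c d ^ (n + 2) * coeffSpan D a b c d := mul_le_mul' ih le_rfl
      _ = coeffSpan D a b c d ^ (n + 1 + 2) := (pow_succ _ _).symm

end Forms

/-! ### Components of Bell states as functions of the rotation -/

lemma prod_mem_pow {R : Type*} [CommRing R] [Algebra ℂ R] (P : Submodule ℂ R) {n : ℕ}
    (f : Fin n → R) (h : ∀ i, f i ∈ P) : ∏ i, f i ∈ P ^ n := by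
  induction n with
  | zero => simp [Submodule.one_le.1 le_rfl]
  | succ n ih =>
    rw [Fin.prod_univ_succ, pow_succ']
    exact Submodule.mul_mem_mul (h 0) (ih _ fun i => h _)

/-- The matrix entry `g i j` as a function of `g`. -/
def entry (i j : Fin 2) : SU2 → ℂ := fun g => g.1 i j

/-- The span of the four matrix entries; its `n`-th power consists of the homogeneous polynomial
functions of degree `n` on `SU(2)`. -/
abbrev entries : Submodule ℂ (SU2 → ℂ) :=
  entrySpan (entry 0 0) (entry 0 1) (entry 1 0) (entry 1 1)

/-- The matrix coefficients of the spin-`J` representation. -/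
abbrev spinCoeffs (J : Spin) : Submodule ℂ (SU2 → ℂ) :=
  coeffSpan J.twice (entry 0 0) (entry 0 1) (entry 1 0) (entry 1 1)

lemma continuous_entry (i j : Fin 2) : Continuous (entry i j) :=
  (continuous_subtype_val (p := fun A => A ∈ Matrix.specialUnitaryGroup (Fin 2) ℂ)).matrix_elem i j

lemma continuous_of_mem {n : ℕ} {f : SU2 → ℂ} (hf : f ∈ entries ^ n) : Continuous f := by
  refine entrySpan_pow_le (P := continuousSubmodule SU2 ℂ ℂ) (fun i j k l _ => ?_) hf
  exact ((((continuous_entry 0 0).pow i).mul ((continuous_entry 0 1).pow j)).mul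
    ((continuous_entry 1 0).pow k)).mul ((continuous_entry 1 1).pow l)

lemma formCoeff_entry_apply (D k l : ℕ) (g : SU2) :
    formCoeff D (entry 0 0) (entry 0 1) (entry 1 0) (entry 1 1) k l g =
      formCoeff D (g.1 0 0) (g.1 0 1) (g.1 1 0) (g.1 1 1) k l :=
  map_formCoeff (Pi.evalRingHom (fun _ : SU2 => ℂ) g) D _ _ _ _ k l

lemma spinMatrix_apply (J : Spin) (g : SU2) (k l : Fin J.dim) :
    spinMatrix J g k l =
      ((Real.sqrt (J.twice.choose l) / Real.sqrt (J.twice.choose k) : ℝ) : ℂ) *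
        formCoeff J.twice (g.1 0 0) (g.1 0 1) (g.1 1 0) (g.1 1 1) k l := rfl

lemma rotatedBell_apply (J : Spin) (g : SU2) (p : Fin J.dim × Fin J.dim) :
    rotatedBell J g p = spinMatrix J g p.1 p.2 * ((1 / Real.sqrt J.dim : ℝ) : ℂ) := by
  rw [rotatedBell, Matrix.mulVec, dotProduct, Fintype.sum_prod_type]
  simp only [Matrix.kroneckerMap_apply, bell, mul_ite, mul_zero, Finset.sum_ite_eq,
    Finset.mem_univ, if_true]
  rw [Finset.sum_eq_single p.2]
  · simp
  · intro b _ hb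
    simp [Matrix.one_apply_ne hb.symm]
  · simp

lemma sqrt_choose_pos {D : ℕ} (k : Fin (D + 1)) : 0 < Real.sqrt (D.choose k) :=
  Real.sqrt_pos.2 (by exact_mod_cast Nat.choose_pos (Nat.lt_succ_iff.1 k.2))

lemma rotatedBell_eq_smul (J : Spin) (p : Fin J.dim × Fin J.dim) :
    ∃ r : ℂ, r ≠ 0 ∧ (fun g => rotatedBell J g p) =
      r • formCoeff J.twice (entry 0 0) (entry 0 1) (entry 1 0) (entry 1 1) p.1 p.2 := by
  refine ⟨((Real.sqrt (J.twice.choose p.2) / Real.sqrt (J.twice.choose p.1) *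
    (1 / Real.sqrt J.dim) : ℝ) : ℂ), ?_, ?_⟩
  · have h1 := sqrt_choose_pos p.1
    have h2 := sqrt_choose_pos p.2
    have h3 : 0 < Real.sqrt J.dim := Real.sqrt_pos.2 (by positivity)
    exact_mod_cast (by positivity :
      0 < Real.sqrt (J.twice.choose p.2) / Real.sqrt (J.twice.choose p.1) *
        (1 / Real.sqrt J.dim)).ne'
  · funext g
    rw [Pi.smul_apply, formCoeff_entry_apply, rotatedBell_apply, spinMatrix_apply, smul_eq_mul,
      Complex.ofReal_mul]
    ring

lemma rotatedBell_mem (J : Spin) (p : Fin J.dim × Fin J.dim) :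
    (fun g => rotatedBell J g p) ∈ entries ^ J.twice := by
  obtain ⟨r, -, h⟩ := rotatedBell_eq_smul J p
  rw [h]
  exact Submodule.smul_mem _ _ (formCoeff_mem_entrySpan_pow (Nat.lt_succ_iff.1 p.2.2) ..)

lemma copies_eq_prod (N : ℕ) (J : Spin) (i : Pairs N J) :
    (fun g => copies N J g i) = ∏ n, fun g => rotatedBell J g (i n) := by
  funext g
  rw [Finset.prod_apply]
  rfl

lemma copies_mem (N : ℕ) (J : Spin) (i : Pairs N J) :
    (fun g => copies N J g i) ∈ entries ^ (J.twice * N) := by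
  rw [copies_eq_prod, pow_mul]
  exact prod_mem_pow _ _ fun n => rotatedBell_mem J (i n)

lemma spinCoeffs_le (J : Spin) :
    spinCoeffs J ≤ Submodule.span ℂ (Set.range fun p g => rotatedBell J g p) := by
  refine Submodule.span_le.2 ?_
  rintro _ ⟨k, hk, l, hl, rfl⟩
  obtain ⟨r, hr, h⟩ :=
    rotatedBell_eq_smul J (⟨k, Nat.lt_succ_of_le hk⟩, ⟨l, Nat.lt_succ_of_le hl⟩)
  rw [SetLike.mem_coe, ← Submodule.smul_mem_iff _ hr]
  rw [← h]
  exact Submodule.subset_span ⟨_, rfl⟩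

lemma spinCoeffs_pow_le (N : ℕ) (J : Spin) :
    spinCoeffs J ^ N ≤ Submodule.span ℂ (Set.range fun i g => copies N J g i) := by
  refine (pow_le_pow_left' (spinCoeffs_le J) N).trans ?_
  rw [Submodule.span_pow, Submodule.span_le]
  intro x hx
  obtain ⟨f, rfl⟩ := Set.mem_pow.1 hx
  choose i hi using fun n => (f n).2
  refine Submodule.subset_span ⟨i, ?_⟩
  rw [List.prod_ofFn]
  refine (copies_eq_prod N J i).trans (Finset.prod_congr rfl fun n _ => hi n)

/-- Every homogeneous polynomial function of degree `2JN` is a linear function of the components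
of `N ≥ 2` rotated spin-`J` Bell states. -/
lemma exists_coeffs {N : ℕ} (hN : 1 < N) (J : Spin) {f : SU2 → ℂ}
    (hf : f ∈ entries ^ (J.twice * N)) :
    ∃ α : Pairs N J → ℂ, ∀ g, f g = ∑ i, α i * copies N J g i := by
  obtain ⟨n, rfl⟩ : ∃ n, N = n + 2 := ⟨N - 2, by omega⟩
  have h := spinCoeffs_pow_le _ _ (entrySpan_pow_le_coeffSpan_pow _ _ _ _ _ n hf)
  obtain ⟨α, hα⟩ := (Submodule.mem_span_range_iff_exists_fun ℂ).1 h
  refine ⟨α, fun g => ?_⟩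
  rw [← hα, Finset.sum_apply]
  rfl

/-! ### Normalization of the rotated Bell states -/

/-- Generating function of a column: the binomial weights cancel the denominators, leaving the
transformed form evaluated at `x`. -/
lemma sum_sqrt_choose_mul_spinMatrix (J : Spin) (g : SU2) (l : Fin J.dim) (x : ℂ) :
    ∑ k : Fin J.dim, ((Real.sqrt (J.twice.choose k) : ℝ) : ℂ) * x ^ (k : ℕ) * spinMatrix J g k l =
      ((Real.sqrt (J.twice.choose l) : ℝ) : ℂ) *
        ((g.1 0 0 + g.1 1 0 * x) ^ (J.twice - (l : ℕ)) * (g.1 0 1 + g.1 1 1 * x) ^ (l : ℕ)) := by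
  open Polynomial in
  have hdeg : ((C (g.1 0 0) + C (g.1 1 0) * X) ^ (J.twice - (l : ℕ)) *
      (C (g.1 0 1) + C (g.1 1 1) * X) ^ (l : ℕ)).natDegree < J.dim := by
    have h := natDegree_mul_le_of_le
      (natDegree_linear_pow_le (g.1 0 0) (g.1 1 0) (J.twice - (l : ℕ)))
      (natDegree_linear_pow_le (g.1 0 1) (g.1 1 1) (l : ℕ))
    have := l.2
    change _ < J.twice + 1
    change _ < J.twice + 1 at this
    omega
  have he := Polynomial.eval_eq_sum_range' hdeg x
  simp only [Polynomial.eval_mul, Polynomial.eval_pow, Polynomial.eval_add, Polynomial.eval_C,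
    Polynomial.eval_X] at he
  rw [he, Finset.sum_range, Finset.mul_sum]
  refine Finset.sum_congr rfl fun k _ => ?_
  have h : ((Real.sqrt (J.twice.choose k) : ℝ) : ℂ) ≠ 0 :=
    Complex.ofReal_ne_zero.2 (sqrt_choose_pos k).ne'
  rw [spinMatrix_apply, formCoeff, Complex.ofReal_div]
  field_simp

lemma mul_star_self (g : SU2) (i j : Fin 2) :
    g.1 i 0 * star (g.1 j 0) + g.1 i 1 * star (g.1 j 1) = if i = j then 1 else 0 := by
  have h := (Matrix.mem_unitaryGroup_iff.1 (Matrix.mem_specialUnitaryGroup_iff.1 g.2).1)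
  have h' := congrFun (congrFun h i) j
  rwa [Matrix.mul_apply, Fin.sum_univ_two, Matrix.star_apply, Matrix.star_apply,
    Matrix.one_apply] at h'

lemma eq_zero_of_forall_sum_pow {n : ℕ} {v : Fin n → ℂ}
    (h : ∀ x : ℂ, ∑ k : Fin n, x ^ (k : ℕ) * v k = 0) : v = 0 :=
  Matrix.eq_zero_of_forall_index_sum_pow_mul_eq_zero (f := fun i : Fin n => ((i : ℕ) : ℂ))
    (fun _ _ hij => Fin.ext (Nat.cast_injective hij)) fun _ => h _

/-- The rows of the spin matrices are orthonormal. -/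
lemma sum_star_spinMatrix_mul (J : Spin) (g : SU2) (k k' : Fin J.dim) :
    ∑ l, star (spinMatrix J g k l) * spinMatrix J g k' l = if k = k' then 1 else 0 := by
  set w : Fin J.dim → ℂ := fun k => ((Real.sqrt (J.twice.choose k) : ℝ) : ℂ) with hw
  have hw0 : ∀ k, w k ≠ 0 := fun k => Complex.ofReal_ne_zero.2 (sqrt_choose_pos k).ne'
  have hws : ∀ k, star (w k) = w k := fun k => Complex.conj_ofReal _
  have hww : ∀ k : Fin J.dim, w k * w k = (J.twice.choose k : ℂ) := fun k => by
    rw [hw]; dsimp only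
    rw [← Complex.ofReal_mul, Real.mul_self_sqrt (by positivity)]; simp
  set H : Fin J.dim → Fin J.dim → ℂ :=
    fun k k' => ∑ l, star (spinMatrix J g k l) * spinMatrix J g k' l with hH
  -- Compare generating functions in `x, y`: by the binomial theorem and unitarity of `g`, both the
  -- Gram matrix `H` and the identity give `(1 + x * y) ^ (2J)`. Using `star x` inside the
  -- conjugated factor makes it polynomial in `x`.
  have key : ∀ x y : ℂ, ∑ k : Fin J.dim, x ^ (k : ℕ) * ∑ k' : Fin J.dim, y ^ (k' : ℕ) *
      (w k * w k' * (H k k' - if k = k' then 1 else 0)) = 0 := by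
    intro x y
    have h1 : ∑ k : Fin J.dim, x ^ (k : ℕ) *
        ∑ k' : Fin J.dim, y ^ (k' : ℕ) * (w k * w k' * H k k') =
        (1 + x * y) ^ J.twice := by
      have h2 : ∀ l, star (∑ k : Fin J.dim, w k * star x ^ (k : ℕ) * spinMatrix J g k l) =
          ∑ k : Fin J.dim, w k * x ^ (k : ℕ) * star (spinMatrix J g k l) := by
        intro l
        simp [hws, star_sum]
      have h3 : ∑ k : Fin J.dim, x ^ (k : ℕ) *
          ∑ k' : Fin J.dim, y ^ (k' : ℕ) * (w k * w k' * H k k') =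
          ∑ l, star (∑ k : Fin J.dim, w k * star x ^ (k : ℕ) * spinMatrix J g k l) *
            ∑ k' : Fin J.dim, w k' * y ^ (k' : ℕ) * spinMatrix J g k' l := by
        simp only [h2, hH, Finset.sum_mul_sum]
        rw [Finset.sum_comm]
        refine Finset.sum_congr rfl fun k _ => ?_
        rw [Finset.sum_comm, Finset.mul_sum]
        refine Finset.sum_congr rfl fun k' _ => ?_
        rw [Finset.mul_sum, Finset.mul_sum, Finset.mul_sum]
        exact Finset.sum_congr rfl fun l _ => by ring
      rw [h3]
      have ha := mul_star_self g 0 0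
      have hb := mul_star_self g 0 1
      have hc := mul_star_self g 1 0
      have hd := mul_star_self g 1 1
      simp only [if_true, if_false, zero_ne_one, one_ne_zero, Fin.isValue] at ha hb hc hd
      rw [show 1 + x * y =
        star (g.1 0 1 + g.1 1 1 * star x) * (g.1 0 1 + g.1 1 1 * y) +
        star (g.1 0 0 + g.1 1 0 * star x) * (g.1 0 0 + g.1 1 0 * y) by
          simp only [star_add, star_mul', star_star]
          linear_combination -ha - y * hc - x * hb - x * y * hd, add_pow,
        Finset.sum_range]
      refine Finset.sum_congr rfl fun l _ => ?_
      rw [sum_sqrt_choose_mul_spinMatrix, sum_sqrt_choose_mul_spinMatrix, star_mul', ← hww l]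
      change star (w l) * _ * (w l * _) = _
      rw [hws]
      simp only [star_mul', star_pow, mul_pow]
      ring
    have h4 : ∑ k : Fin J.dim, x ^ (k : ℕ) *
        ∑ k' : Fin J.dim, y ^ (k' : ℕ) * (w k * w k' * if k = k' then 1 else 0) =
        (1 + x * y) ^ J.twice := by
      rw [add_comm, add_pow, Finset.sum_range]
      refine Finset.sum_congr rfl fun k _ => ?_
      simp only [mul_ite, mul_one, mul_zero, Finset.sum_ite_eq, Finset.mem_univ, if_true, hww]
      ring
    simp only [mul_sub, Finset.sum_sub_distrib] at *
    rw [h1, h4, sub_self]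
  have h5 : ∀ y : ℂ, ∀ k, ∑ k' : Fin J.dim, y ^ (k' : ℕ) *
      (w k * w k' * (H k k' - if k = k' then 1 else 0)) = 0 :=
    fun y k => congrFun (eq_zero_of_forall_sum_pow fun x => key x y) k
  have h6 := congrFun (eq_zero_of_forall_sum_pow fun y => h5 y k) k'
  have h7 := (mul_eq_zero.1 h6).resolve_left (mul_ne_zero (hw0 k) (hw0 k'))
  exact sub_eq_zero.1 h7

lemma sum_star_rotatedBell_mul_self (J : Spin) (g : SU2) :
    ∑ p, star (rotatedBell J g p) * rotatedBell J g p = 1 := by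
  have h : ∀ p, star (rotatedBell J g p) * rotatedBell J g p =
      star (spinMatrix J g p.1 p.2) * spinMatrix J g p.1 p.2 * (J.dim : ℂ)⁻¹ := by
    intro p
    have h1 : ((1 / Real.sqrt J.dim : ℝ) : ℂ) * ((1 / Real.sqrt J.dim : ℝ) : ℂ) =
        (J.dim : ℂ)⁻¹ := by
      rw [← Complex.ofReal_mul, div_mul_div_comm, Real.mul_self_sqrt (by positivity)]; simp
    rw [rotatedBell_apply, star_mul', Complex.star_def, Complex.conj_ofReal, ← h1]
    ring
  simp only [h]
  rw [← Finset.sum_mul, Fintype.sum_prod_type]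
  simp only [sum_star_spinMatrix_mul, if_true, Finset.sum_const, Finset.card_univ,
    Fintype.card_fin, nsmul_eq_mul, mul_one]
  exact mul_inv_cancel₀ (by exact_mod_cast (Nat.succ_ne_zero J.twice))

lemma star_copies_dotProduct_self (N : ℕ) (J : Spin) (g : SU2) :
    star (copies N J g) ⬝ᵥ copies N J g = 1 := by
  have h : ∀ i : Pairs N J, star (copies N J g) i * copies N J g i =
      ∏ n, star (rotatedBell J g (i n)) * rotatedBell J g (i n) := by
    intro i
    rw [Finset.prod_mul_distrib, ← star_prod]
    rfl
  simp only [dotProduct, h]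
  rw [← Fintype.prod_sum (fun (_ : Fin N) p => star (rotatedBell J g p) * rotatedBell J g p)]
  simp only [sum_star_rotatedBell_mul_self, Finset.prod_const_one]

/-! ### Averages over the group -/

instance : IsProbabilityMeasure haarSU2 := by
  refine ⟨?_⟩
  have h := Measure.haarMeasure_self (K₀ := (⊤ : TopologicalSpace.PositiveCompacts SU2))
  rwa [TopologicalSpace.PositiveCompacts.coe_top] at h

instance : Measure.IsOpenPosMeasure haarSU2 := by
  unfold haarSU2; infer_instance

lemma integrable_haarSU2 {f : SU2 → ℝ} (hf : Continuous f) : Integrable f haarSU2 :=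
  hf.integrable_of_hasCompactSupport (HasCompactSupport.of_compactSpace f)

/-- Haar measure charges every nonempty open set, so for a continuous function vanishing almost
everywhere means vanishing everywhere. -/
lemma eq_zero_of_integral_eq_zero {f : SU2 → ℝ} (hf : Continuous f) (h0 : ∀ g, 0 ≤ f g)
    (h : ∫ g, f g ∂haarSU2 = 0) (g : SU2) : f g = 0 := by
  have h1 := (integral_eq_zero_iff_of_nonneg h0 (integrable_haarSU2 hf)).1 h
  exact congrFun ((hf.ae_eq_iff_eq haarSU2 continuous_zero).1 h1) g

/-! ### Entries of `SU(2)` matrices and the left action of the diagonal torus -/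

lemma det_eq_one (g : SU2) : g.1 0 0 * g.1 1 1 - g.1 0 1 * g.1 1 0 = 1 := by
  rw [← Matrix.det_fin_two]
  exact (Matrix.mem_specialUnitaryGroup_iff.1 g.2).2

lemma star_entry_one_one (g : SU2) : star (g.1 1 1) = g.1 0 0 := by
  have h1 := mul_star_self g 0 1
  have h2 := mul_star_self g 1 1
  have h3 := det_eq_one g
  simp only [if_true, if_false, zero_ne_one, Fin.isValue] at h1 h2
  linear_combination g.1 0 0 * h2 - g.1 1 0 * h1 - star (g.1 1 1) * h3

lemma star_entry_one_zero (g : SU2) : star (g.1 1 0) = -g.1 0 1 := by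
  have h1 := mul_star_self g 0 1
  have h2 := mul_star_self g 1 1
  have h3 := det_eq_one g
  simp only [if_true, if_false, zero_ne_one, Fin.isValue] at h1 h2
  linear_combination -g.1 0 1 * h2 + g.1 1 1 * h1 - star (g.1 1 0) * h3

lemma star_entry_zero_zero (g : SU2) : star (g.1 0 0) = g.1 1 1 := by
  rw [← star_entry_one_one, star_star]

lemma star_entry_zero_one (g : SU2) : star (g.1 0 1) = -g.1 1 0 := by
  rw [eq_neg_iff_add_eq_zero, add_comm, ← neg_eq_iff_add_eq_zero, ← star_star (g.1 1 0),
    star_entry_one_zero, star_neg, neg_neg]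

/-- On `SU(2)` conjugation exchanges `a` with `d` and `b` with `-c`, so it preserves degree. -/
lemma star_mem {n : ℕ} {f : SU2 → ℂ} (hf : f ∈ entries ^ n) : star f ∈ entries ^ n := by
  let P : Submodule ℂ (SU2 → ℂ) :=
    { carrier := {f | star f ∈ entries ^ n}
      add_mem' := fun {x y} hx hy => by
        rw [Set.mem_ofPred_eq, star_add]; exact Submodule.add_mem _ hx hy
      zero_mem' := by rw [Set.mem_ofPred_eq, star_zero]; exact Submodule.zero_mem _
      smul_mem' := fun c x hx => by
        rw [Set.mem_ofPred_eq, star_smul]; exact Submodule.smul_mem _ _ hx }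
  refine entrySpan_pow_le (P := P) (fun i j k l hn => ?_) hf
  have h := monomial_mem_entrySpan_pow (entry 0 0) (entry 0 1) (entry 1 0) (entry 1 1) l k j i
  rw [show l + k + j + i = n by omega] at h
  change star (entry 0 0 ^ i * entry 0 1 ^ j * entry 1 0 ^ k * entry 1 1 ^ l) ∈ entries ^ n
  convert Submodule.smul_mem _ ((-1 : ℂ) ^ (j + k)) h using 1
  funext g
  simp only [Pi.star_apply, Pi.mul_apply, Pi.pow_apply, Pi.smul_apply, smul_eq_mul, star_mul',
    star_pow, entry, star_entry_zero_zero, star_entry_zero_one, star_entry_one_zero,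
    star_entry_one_one]
  rw [neg_pow (g.1 1 0), neg_pow (g.1 0 1), pow_add]
  ring

/-- The diagonal matrix with entries `z, z⁻¹`. -/
def torus (z : ℂ) (hz : z * star z = 1) : SU2 :=
  ⟨!![z, 0; 0, star z], by
    rw [Matrix.mem_specialUnitaryGroup_iff, Matrix.mem_unitaryGroup_iff]
    constructor
    · have hz' : z * (starRingEnd ℂ) z = 1 := hz
      ext i j
      fin_cases i <;> fin_cases j <;>
        simp [Matrix.mul_apply, Fin.sum_univ_two, Matrix.star_apply, hz',
          mul_comm ((starRingEnd ℂ) z)]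
    · simpa [Matrix.det_fin_two] using hz⟩

lemma torus_mul_zero (z : ℂ) (hz : z * star z = 1) (g : SU2) (j : Fin 2) :
    (torus z hz * g).1 0 j = z * g.1 0 j := by
  change (!![z, 0; 0, star z] * g.1) 0 j = _
  simp [Matrix.mul_apply, Fin.sum_univ_two]

lemma torus_mul_one (z : ℂ) (hz : z * star z = 1) (g : SU2) (j : Fin 2) :
    (torus z hz * g).1 1 j = star z * g.1 1 j := by
  change (!![z, 0; 0, star z] * g.1) 1 j = _
  simp [Matrix.mul_apply, Fin.sum_univ_two]

lemma torus_one_mul (g : SU2) (h : (1 : ℂ) * star 1 = 1) : torus 1 h * g = g := by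
  refine Subtype.ext (Matrix.ext fun i j => ?_)
  fin_cases i
  · exact (torus_mul_zero 1 h g j).trans (one_mul _)
  · exact (torus_mul_one 1 h g j).trans (by simp)

/-- A discrete Fourier projection: a monomial of degree `p` has torus weight at most `p < m`, so it
has no component of weight `m`. The bound `m + p < q` keeps distinct weights distinct modulo `q`. -/
lemma sum_weight_eq_zero {q : ℕ} {ζ : ℂ} (hζ : IsPrimitiveRoot ζ q)
    (hu : ∀ j : ℕ, ζ ^ j * star (ζ ^ j) = 1) {p m : ℕ} (hpm : p < m) (hq : m + p < q)
    {f : SU2 → ℂ} (hf : f ∈ entries ^ p) (g : SU2) :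
    ∑ j ∈ Finset.range q, star (ζ ^ j) ^ m * f (torus (ζ ^ j) (hu j) * g) = 0 := by
  let P : Submodule ℂ (SU2 → ℂ) :=
    { carrier := {f | ∑ j ∈ Finset.range q,
        star (ζ ^ j) ^ m * f (torus (ζ ^ j) (hu j) * g) = 0}
      add_mem' := fun {x y} hx hy => by
        rw [Set.mem_ofPred_eq] at hx hy ⊢
        simp only [Pi.add_apply, mul_add, Finset.sum_add_distrib, hx, hy, add_zero]
      zero_mem' := by simp
      smul_mem' := fun c x hx => by
        rw [Set.mem_ofPred_eq] at hx ⊢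
        simp only [Pi.smul_apply, smul_eq_mul, mul_left_comm _ c]
        rw [← Finset.mul_sum, hx, mul_zero] }
  refine entrySpan_pow_le (P := P) (fun i₁ i₂ i₃ i₄ hn => ?_) hf
  change ∑ j ∈ Finset.range q, _ = (0 : ℂ)
  -- The ratio of the geometric series: the first row scales by `ζ`, the second row and the extra
  -- weight by its conjugate.
  set ω : ℂ := ζ ^ (i₁ + i₂) * star ζ ^ (i₃ + i₄ + m) with hω
  have hu1 : ζ * star ζ = 1 := by simpa using hu 1
  have hω1 : ω ≠ 1 := by
    intro h
    have h1 : ζ ^ (i₁ + i₂) = ζ ^ (i₃ + i₄ + m) := by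
      calc ζ ^ (i₁ + i₂) = ζ ^ (i₁ + i₂) * (ζ * star ζ) ^ (i₃ + i₄ + m) := by
            rw [hu1, one_pow, mul_one]
        _ = ω * ζ ^ (i₃ + i₄ + m) := by rw [hω, mul_pow]; ring
        _ = _ := by rw [h, one_mul]
    have := hζ.pow_inj (by omega) (by omega) h1
    omega
  have hωq : ω ^ q = 1 := by
    have hs : star ζ ^ q = 1 := by rw [← star_pow, hζ.pow_eq_one, star_one]
    rw [hω, mul_pow, ← pow_mul, ← pow_mul, mul_comm _ q, mul_comm _ q, pow_mul, pow_mul,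
      hζ.pow_eq_one, hs, one_pow, one_pow, one_mul]
  have hsum : ∑ j ∈ Finset.range q, ω ^ j = 0 := by
    rw [geom_sum_eq hω1, hωq, sub_self, zero_div]
  rw [← zero_mul (g.1 0 0 ^ i₁ * g.1 0 1 ^ i₂ * g.1 1 0 ^ i₃ * g.1 1 1 ^ i₄), ← hsum,
    Finset.sum_mul]
  refine Finset.sum_congr rfl fun j _ => ?_
  simp only [Pi.mul_apply, Pi.pow_apply, entry, torus_mul_zero, torus_mul_one, mul_pow, hω,
    star_pow, pow_add, ← pow_mul]
  simp only [mul_comm j]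
  ring

/-- A nonnegative function whose product with `(g 0 i) ^ m` is a polynomial of degree `p < m`
vanishes where `g 0 i` does not: its average over the diagonal torus is zero. -/
lemma eq_zero_of_mul_pow_mem {s : SU2 → ℝ} (hs : ∀ g, 0 ≤ s g) {p m : ℕ} (hpm : p < m)
    (i : Fin 2) (h : (fun g => (s g : ℂ) * entry 0 i g ^ m) ∈ entries ^ p) (g : SU2)
    (hg : g.1 0 i ≠ 0) : s g = 0 := by
  have hq : m + p + 1 ≠ 0 := Nat.succ_ne_zero _
  have hζ := Complex.isPrimitiveRoot_exp (m + p + 1) hq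
  set ζ := Complex.exp (2 * Real.pi * Complex.I / ((m + p + 1 : ℕ) : ℂ))
  have hn : ‖ζ‖ = 1 := hζ.norm'_eq_one hq
  have hu : ∀ j : ℕ, ζ ^ j * star (ζ ^ j) = 1 := fun j => by
    rw [Complex.star_def, Complex.mul_conj, Complex.normSq_eq_norm_sq, norm_pow, hn]; simp
  have h0 := sum_weight_eq_zero hζ hu hpm (Nat.lt_succ_self _) h g
  have h1 : ∀ j, star (ζ ^ j) ^ m * ((s (torus (ζ ^ j) (hu j) * g) : ℂ) *
      entry 0 i (torus (ζ ^ j) (hu j) * g) ^ m) =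
        (s (torus (ζ ^ j) (hu j) * g) : ℂ) * g.1 0 i ^ m := by
    intro j
    rw [entry, torus_mul_zero, mul_pow]
    have := congrArg (· ^ m) (hu j)
    simp only [mul_pow, one_pow] at this
    linear_combination (s (torus (ζ ^ j) (hu j) * g) : ℂ) * g.1 0 i ^ m * this
  simp only [h1] at h0
  rw [← Finset.sum_mul] at h0
  have h2 := (mul_eq_zero.1 h0).resolve_right (pow_ne_zero _ hg)
  rw [← Complex.ofReal_sum, Complex.ofReal_eq_zero,
    Finset.sum_eq_zero_iff_of_nonneg fun _ _ => hs _] at h2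
  -- The term `j = 0` of the vanishing sum of nonnegative terms is `s g` itself.
  have h3 := h2 0 (by simp)
  have h4 : torus (ζ ^ 0) (hu 0) * g = g := by
    simp only [pow_zero]; exact torus_one_mul g _
  rwa [h4] at h3

lemma eq_zero_of_forall_mul_pow_mem {s : SU2 → ℝ} (hs : ∀ g, 0 ≤ s g) {p m : ℕ} (hpm : p < m)
    (h : ∀ i, (fun g => (s g : ℂ) * entry 0 i g ^ m) ∈ entries ^ p) (g : SU2) : s g = 0 := by
  by_cases h0 : g.1 0 0 = 0
  · refine eq_zero_of_mul_pow_mem hs hpm 1 (h 1) g fun h1 => ?_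
    have := det_eq_one g
    rw [h0, h1] at this
    simp at this
  · exact eq_zero_of_mul_pow_mem hs hpm 0 (h 0) g h0

/-! ### Positive semidefinite matrices with a unit-fidelity pure state -/

section PosSemidef

variable {α β : Type} [Fintype α] [Fintype β]

open scoped MatrixOrder Matrix.Norms.L2Operator in
lemma exists_eq_conjTranspose_mul_self {B : Matrix α α ℂ} (hB : B.PosSemidef) :
    ∃ C : Matrix α α ℂ, B = Cᴴ * C := by
  classical
  obtain ⟨C, hC⟩ := CStarAlgebra.nonneg_iff_eq_star_mul_self.mp hB.nonneg
  exact ⟨C, hC⟩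

lemma trace_eq_re {B : Matrix α α ℂ} (hB : B.PosSemidef) : B.trace = (B.trace.re : ℂ) :=
  Complex.ext rfl (Complex.nonneg_iff.1 hB.trace_nonneg).2.symm

variable [DecidableEq α]

lemma trace_compress (B : Matrix α α ℂ) {φ : α → ℂ} (hφ : star φ ⬝ᵥ φ = 1) :
    ((1 - pureState φ)ᴴ * B * (1 - pureState φ)).trace = B.trace - star φ ⬝ᵥ (B *ᵥ φ) := by
  have hH : (pureState φ)ᴴ = pureState φ := by
    rw [pureState, Matrix.conjTranspose_vecMulVec, star_star]
  have hP : pureState φ * pureState φ = pureState φ := by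
    rw [pureState, Matrix.vecMulVec_mul_vecMulVec, hφ, one_smul]
  rw [Matrix.conjTranspose_sub, Matrix.conjTranspose_one, hH, Matrix.trace_mul_comm,
    ← Matrix.mul_assoc, sub_mul, mul_sub, mul_sub, hP]
  simp only [mul_one, one_mul, sub_self, sub_zero]
  rw [sub_mul, one_mul, Matrix.trace_sub, Matrix.trace_mul_comm, pureState,
    Matrix.mul_vecMulVec, Matrix.trace_vecMulVec, dotProduct_comm]

lemma re_overlap_le_trace {B : Matrix α α ℂ} (hB : B.PosSemidef) {φ : α → ℂ}
    (hφ : star φ ⬝ᵥ φ = 1) : (star φ ⬝ᵥ (B *ᵥ φ)).re ≤ B.trace.re := by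
  have h := (Complex.nonneg_iff.1 (hB.conjTranspose_mul_mul_same (1 - pureState φ)).trace_nonneg).1
  rw [trace_compress B hφ, Complex.sub_re] at h
  linarith

/-- With `P` the projector on `φ`, the compression of `B` by `1 - P` is positive with trace zero.
Writing `B` as `Cᴴ * C` gives `C * (1 - P) = 0`, so `B = B * P`; being Hermitian, `B` is then a
multiple of `P`, and the trace fixes the factor. -/
lemma apply_eq_of_re_overlap_eq_trace {B : Matrix α α ℂ} (hB : B.PosSemidef) {φ : α → ℂ}
    (hφ : star φ ⬝ᵥ φ = 1) (h : (star φ ⬝ᵥ (B *ᵥ φ)).re = B.trace.re) (x y : α) :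
    B x y = (B.trace.re : ℂ) * (φ x * star (φ y)) := by
  have hT := hB.conjTranspose_mul_mul_same (1 - pureState φ)
  have hT0 : ((1 - pureState φ)ᴴ * B * (1 - pureState φ)).trace = 0 := by
    rw [trace_eq_re hT, trace_compress B hφ, Complex.sub_re, h, sub_self, Complex.ofReal_zero]
  obtain ⟨C, hC⟩ := exists_eq_conjTranspose_mul_self hB
  have hCQ : C * (1 - pureState φ) = 0 := by
    rw [← Matrix.trace_conjTranspose_mul_self_eq_zero_iff, Matrix.conjTranspose_mul, ← hT0, hC]
    simp only [Matrix.mul_assoc]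
  have hBP : B = Matrix.vecMulVec (B *ᵥ φ) (star φ) := by
    have h1 : B * (1 - pureState φ) = 0 := by
      rw [hC, Matrix.mul_assoc, hCQ, Matrix.mul_zero]
    rw [mul_sub, mul_one, sub_eq_zero, pureState, Matrix.mul_vecMulVec] at h1
    exact h1
  have h1 : ∀ x y, B x y = (B *ᵥ φ) x * star (φ y) := fun x y => congrFun (congrFun hBP x) y
  have h2 : ∀ x y, B x y = φ x * star ((B *ᵥ φ) y) := fun x y => by
    rw [← hB.isHermitian.apply x y, h1 y x, star_mul', star_star, mul_comm]
  have h3 : ∀ x, (B *ᵥ φ) x = φ x * (star (B *ᵥ φ) ⬝ᵥ φ) := fun x => by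
    rw [Matrix.mulVec, dotProduct, dotProduct, Finset.mul_sum]
    exact Finset.sum_congr rfl fun y _ => by rw [h2 x y, mul_assoc]; rfl
  have h4 : B.trace = star (B *ᵥ φ) ⬝ᵥ φ := by
    have h5 : B.trace = ∑ y, φ y * star ((B *ᵥ φ) y) := Finset.sum_congr rfl fun y _ => h2 y y
    rw [h5, dotProduct]
    exact Finset.sum_congr rfl fun y _ => mul_comm _ _
  rw [← trace_eq_re hB, h4, h1, h3]
  ring

end PosSemidef

/-! ### Quantum operations -/

section Operations

variable {α β : Type}

lemma CompletelyPositive.posSemidef {Φ : Matrix α α ℂ →ₗ[ℂ] Matrix β β ℂ}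
    (hΦ : CompletelyPositive Φ) {X : Matrix α α ℂ} (hX : X.PosSemidef) : (Φ X).PosSemidef :=
  (hΦ 1 _ (hX.submatrix Prod.snd)).submatrix fun b => (0, b)

variable [Fintype α]

lemma posSemidef_pureState (ψ : α → ℂ) : (pureState ψ).PosSemidef :=
  Matrix.posSemidef_vecMulVec_self_star ψ

lemma trace_pureState (φ : α → ℂ) : (pureState φ).trace = star φ ⬝ᵥ φ := by
  rw [pureState, Matrix.trace_vecMulVec, dotProduct_comm]

lemma conj_pureState (A : Matrix β α ℂ) (ψ : α → ℂ) :
    A * pureState ψ * Aᴴ = pureState (A *ᵥ ψ) := by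
  rw [pureState, Matrix.mul_vecMulVec, Matrix.vecMulVec_mul, pureState, Matrix.star_mulVec]

lemma ampliation_conj (k : ℕ) (A : Matrix β α ℂ) (Φ : Matrix α α ℂ →ₗ[ℂ] Matrix β β ℂ) (r : ℂ)
    (hΦ : ∀ X, Φ X = r • (A * X * Aᴴ)) (X : Matrix (Fin k × α) (Fin k × α) ℂ) :
    ampliation k Φ X = r • (((1 : Matrix (Fin k) (Fin k) ℂ) ⊗ₖ A) * X *
      ((1 : Matrix (Fin k) (Fin k) ℂ) ⊗ₖ A)ᴴ) := by
  ext ⟨p, x⟩ ⟨q, y⟩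
  simp only [ampliation, Matrix.of_apply, hΦ, Matrix.smul_apply, Matrix.mul_apply,
    Matrix.conjTranspose_apply, Matrix.kroneckerMap_apply, Fintype.sum_prod_type,
    Matrix.one_apply]
  congr 1
  simp [Finset.sum_ite_eq, apply_ite, ite_mul, Finset.sum_mul]

variable [Fintype β]

open scoped Matrix.Norms.Frobenius in
lemma re_trace_conjTranspose_mul_self (B : Matrix α β ℂ) : (Bᴴ * B).trace.re = ‖B‖ ^ 2 := by
  rw [Matrix.frobenius_norm_def, ← Real.sqrt_eq_rpow, Real.sq_sqrt (by positivity),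
    Matrix.trace, Complex.re_sum, Finset.sum_comm]
  refine Finset.sum_congr rfl fun j _ => ?_
  rw [Matrix.diag_apply, Matrix.mul_apply, Complex.re_sum]
  refine Finset.sum_congr rfl fun i _ => ?_
  rw [Matrix.conjTranspose_apply, Real.rpow_two, Complex.star_def, mul_comm, Complex.mul_conj,
    Complex.ofReal_re, Complex.normSq_eq_norm_sq]

open scoped Matrix.Norms.Frobenius in
-- For `ρ = Bᴴ * B` both traces are squared Frobenius norms, and that norm is submultiplicative.
lemma exists_re_trace_conj_le (A : Matrix β α ℂ) :
    ∃ c : ℝ, 0 < c ∧ ∀ ρ : Matrix α α ℂ, ρ.PosSemidef →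
      (A * ρ * Aᴴ).trace.re ≤ c * ρ.trace.re := by
  -- The `+ 1` keeps the constant invertible when `A = 0`.
  refine ⟨‖A‖ ^ 2 + 1, by positivity, fun ρ hρ => ?_⟩
  obtain ⟨B, rfl⟩ := exists_eq_conjTranspose_mul_self hρ
  have h1 : A * (Bᴴ * B) * Aᴴ = (B * Aᴴ)ᴴ * (B * Aᴴ) := by
    rw [Matrix.conjTranspose_mul, Matrix.conjTranspose_conjTranspose]
    simp only [Matrix.mul_assoc]
  rw [h1, re_trace_conjTranspose_mul_self, re_trace_conjTranspose_mul_self]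
  have h2 : ‖B * Aᴴ‖ ≤ ‖B‖ * ‖A‖ := by
    rw [← Matrix.frobenius_norm_conjTranspose A]; exact Matrix.frobenius_norm_mul _ _
  calc ‖B * Aᴴ‖ ^ 2 ≤ (‖B‖ * ‖A‖) ^ 2 := by gcongr
    _ = ‖A‖ ^ 2 * ‖B‖ ^ 2 := by ring
    _ ≤ (‖A‖ ^ 2 + 1) * ‖B‖ ^ 2 := by gcongr; linarith

/-- Conjugation by a matrix is a quantum operation up to a positive factor. -/
lemma exists_operation (A : Matrix β α ℂ) :
    ∃ (r : ℝ) (𝓜 : QuantumOperation α β), 0 < r ∧ ∀ X, 𝓜.toMap X = (r : ℂ) • (A * X * Aᴴ) := by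
  classical
  obtain ⟨c, hc, h⟩ := exists_re_trace_conj_le A
  let Φ : Matrix α α ℂ →ₗ[ℂ] Matrix β β ℂ :=
    { toFun := fun X => ((c⁻¹ : ℝ) : ℂ) • (A * X * Aᴴ)
      map_add' := fun X Y => by rw [Matrix.mul_add, Matrix.add_mul, smul_add]
      map_smul' := fun z X => by
        rw [Matrix.mul_smul, Matrix.smul_mul, smul_comm, RingHom.id_apply] }
  have hΦ : ∀ X, Φ X = ((c⁻¹ : ℝ) : ℂ) • (A * X * Aᴴ) := fun _ => rfl
  refine ⟨c⁻¹, ⟨Φ, fun k X hX => ?_, fun ρ hρ => ?_⟩, inv_pos.2 hc, hΦ⟩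
  · rw [ampliation_conj k A Φ _ hΦ]
    exact (hX.mul_mul_conjTranspose_same _).smul (by exact_mod_cast (inv_pos.2 hc).le)
  · rw [hΦ, Matrix.trace_smul, smul_eq_mul, Complex.re_ofReal_mul, inv_mul_le_iff₀ hc]
    exact h ρ hρ

end Operations

variable {N M : ℕ} {J K : Spin}

/-- The output is linear in the density matrix, hence bilinear in the input components and their
conjugates; each contributes degree `2JN`. -/
lemma output_apply_mem (𝓜 : QuantumOperation (Pairs N J) (Pairs M K)) (x y : Pairs M K) :
    (fun g => 𝓜.toMap (pureState (copies N J g)) x y) ∈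
      entries ^ (J.twice * N + J.twice * N) := by
  have h : (fun g => 𝓜.toMap (pureState (copies N J g)) x y) =
      ∑ i, ∑ j, (𝓜.toMap (Matrix.single i j 1) x y) •
        ((fun g => copies N J g i) * star fun g => copies N J g j) := by
    funext g
    conv_lhs => rw [Matrix.matrix_eq_sum_single (pureState (copies N J g))]
    simp only [map_sum, Matrix.sum_apply, Finset.sum_apply]
    refine Finset.sum_congr rfl fun i _ => Finset.sum_congr rfl fun j _ => ?_
    have h1 : Matrix.single i j (pureState (copies N J g) i j) =
        pureState (copies N J g) i j • Matrix.single i j (1 : ℂ) := by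
      rw [Matrix.smul_single, smul_eq_mul, mul_one]
    rw [h1, map_smul, Matrix.smul_apply, smul_eq_mul, mul_comm]
    rfl
  rw [h]
  refine Submodule.sum_mem _ fun i _ => Submodule.sum_mem _ fun j _ => Submodule.smul_mem _ _ ?_
  rw [pow_add]
  exact Submodule.mul_mem_mul (copies_mem N J i) (star_mem (copies_mem N J j))

lemma continuous_successProbAt (𝓜 : QuantumOperation (Pairs N J) (Pairs M K)) :
    Continuous (successProbAt 𝓜) :=
  Complex.continuous_re.comp
    (continuous_finsetSum _ fun x _ => continuous_of_mem (output_apply_mem 𝓜 x x))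

lemma continuous_overlapAt (𝓜 : QuantumOperation (Pairs N J) (Pairs M K)) :
    Continuous (overlapAt 𝓜) := by
  have hc : ∀ x, Continuous fun g => copies M K g x := fun x => continuous_of_mem (copies_mem M K x)
  refine Complex.continuous_re.comp (continuous_finsetSum _ fun x _ => ?_)
  exact (continuous_star.comp (hc x)).mul (continuous_finsetSum _ fun y _ =>
    (continuous_of_mem (output_apply_mem 𝓜 x y)).mul (hc y))

lemma output_posSemidef (𝓜 : QuantumOperation (Pairs N J) (Pairs M K)) (g : SU2) :
    (𝓜.toMap (pureState (copies N J g))).PosSemidef :=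
  𝓜.completelyPositive.posSemidef (posSemidef_pureState _)

lemma successProbAt_nonneg (𝓜 : QuantumOperation (Pairs N J) (Pairs M K)) (g : SU2) :
    0 ≤ successProbAt 𝓜 g :=
  (Complex.nonneg_iff.1 (output_posSemidef 𝓜 g).trace_nonneg).1

lemma overlapAt_le (𝓜 : QuantumOperation (Pairs N J) (Pairs M K)) (g : SU2) :
    overlapAt 𝓜 g ≤ successProbAt 𝓜 g :=
  re_overlap_le_trace (output_posSemidef 𝓜 g) (star_copies_dotProduct_self M K g)

/-- Unit fidelity equates only the averages; the pointwise inequality and continuity upgrade this to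
every rotation. -/
lemma overlapAt_eq_of_perfectlyConverts {𝓜 : QuantumOperation (Pairs N J) (Pairs M K)}
    (h : PerfectlyConverts 𝓜) (g : SU2) : overlapAt 𝓜 g = successProbAt 𝓜 g := by
  obtain ⟨h0, h1⟩ := h
  rw [fidelity, div_eq_one_iff_eq h0.ne', successProb] at h1
  have hs := continuous_successProbAt 𝓜
  have ho := continuous_overlapAt 𝓜
  have h2 := eq_zero_of_integral_eq_zero (hs.sub ho) (fun g => sub_nonneg.2 (overlapAt_le 𝓜 g))
    (by
      have := integral_sub (integrable_haarSU2 hs) (integrable_haarSU2 ho)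
      simpa [h1] using this) g
  exact (sub_eq_zero.1 h2).symm

/-! ### The two directions -/

/-- Opposite corners of the spin matrix are `a ^ (2J)`, `d ^ (2J)` and `b ^ (2J)`, `c ^ (2J)` up to
constants; since `star d = a` and `star c = -b`, each pair yields a pure power of a first-row entry.
-/
lemma exists_rotatedBell_mul_star_eq (J : Spin) (i : Fin 2) :
    ∃ (p p' : Fin J.dim × Fin J.dim) (r : ℂ), r ≠ 0 ∧
      ∀ g, rotatedBell J g p * star (rotatedBell J g p') = r * entry 0 i g ^ (2 * J.twice) := by
  fin_cases i
  · obtain ⟨r, hr, h⟩ := rotatedBell_eq_smul J (0, 0)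
    obtain ⟨r', hr', h'⟩ := rotatedBell_eq_smul J (Fin.last _, Fin.last _)
    refine ⟨(0, 0), (Fin.last _, Fin.last _), r * star r',
      mul_ne_zero hr (star_ne_zero.2 hr'), fun g => ?_⟩
    rw [congrFun h g, congrFun h' g, Pi.smul_apply, Pi.smul_apply]
    simp only [Fin.val_zero, Fin.val_last, formCoeff_zero]
    have h1 := formCoeff_swap_rows (Nat.zero_le J.twice) le_rfl
      (entry 0 0) (entry 0 1) (entry 1 0) (entry 1 1)
    rw [Nat.sub_zero] at h1
    rw [← h1, formCoeff_zero]
    simp only [Pi.mul_apply, Pi.pow_apply, smul_eq_mul, star_mul', star_pow, entry,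
      star_entry_one_one, Nat.sub_zero, Nat.sub_self, pow_zero, Pi.one_apply, star_one,
      Fin.zero_eta]
    ring
  · obtain ⟨r, hr, h⟩ := rotatedBell_eq_smul J (0, Fin.last _)
    obtain ⟨r', hr', h'⟩ := rotatedBell_eq_smul J (Fin.last _, 0)
    refine ⟨(0, Fin.last _), (Fin.last _, 0), r * (star r' * (-1) ^ J.twice),
      mul_ne_zero hr (mul_ne_zero (star_ne_zero.2 hr') (by simp)), fun g => ?_⟩
    rw [congrFun h g, congrFun h' g, Pi.smul_apply, Pi.smul_apply]
    simp only [Fin.val_zero, Fin.val_last, formCoeff_zero]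
    have h1 := formCoeff_swap_rows (Nat.zero_le J.twice) (Nat.zero_le J.twice)
      (entry 0 0) (entry 0 1) (entry 1 0) (entry 1 1)
    rw [Nat.sub_zero] at h1
    rw [← h1, formCoeff_zero]
    simp only [Pi.mul_apply, Pi.pow_apply, smul_eq_mul, star_mul', star_pow, entry,
      star_entry_one_zero, Nat.sub_zero, Nat.sub_self, pow_zero, Pi.one_apply, star_one, Fin.mk_one]
    rw [neg_pow]
    ring

lemma exists_copies_mul_star_eq (M : ℕ) (K : Spin) (i : Fin 2) :
    ∃ (x y : Pairs M K) (r : ℂ), r ≠ 0 ∧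
      ∀ g, copies M K g x * star (copies M K g y) = r * entry 0 i g ^ (2 * (K.twice * M)) := by
  obtain ⟨p, p', r, hr, h⟩ := exists_rotatedBell_mul_star_eq K i
  refine ⟨fun _ => p, fun _ => p', r ^ M, pow_ne_zero _ hr, fun g => ?_⟩
  simp only [copies, Finset.prod_const, Finset.card_univ, Fintype.card_fin]
  rw [star_pow, ← mul_pow, h, mul_pow, ← pow_mul, mul_assoc]

lemma le_of_perfectlyConverts {𝓜 : QuantumOperation (Pairs N J) (Pairs M K)}
    (h : PerfectlyConverts 𝓜) : K.twice * M ≤ J.twice * N := by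
  by_contra! hlt
  have h0 : ∀ g, successProbAt 𝓜 g = 0 := by
    refine eq_zero_of_forall_mul_pow_mem (successProbAt_nonneg 𝓜)
      (p := J.twice * N + J.twice * N) (m := 2 * (K.twice * M)) (by omega) fun i => ?_
    obtain ⟨x, y, r, hr, hxy⟩ := exists_copies_mul_star_eq M K i
    rw [← Submodule.smul_mem_iff _ hr]
    convert output_apply_mem 𝓜 x y using 1
    funext g
    have hg := apply_eq_of_re_overlap_eq_trace (output_posSemidef 𝓜 g)
      (star_copies_dotProduct_self M K g) (overlapAt_eq_of_perfectlyConverts h g) x y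
    rw [hg, hxy, Pi.smul_apply, smul_eq_mul, successProbAt]
    ring
  have h1 := h.1
  simp [successProb, h0] at h1

lemma exists_perfectlyConverts (hN : 1 < N) (h : K.twice * M ≤ J.twice * N) :
    ∃ 𝓜 : QuantumOperation (Pairs N J) (Pairs M K), PerfectlyConverts 𝓜 := by
  obtain ⟨δ, hδ⟩ := Nat.exists_eq_add_of_le h
  have hmem : ∀ x : Pairs M K, (fun g => copies M K g x) * entry 0 0 ^ δ ∈
      entries ^ (J.twice * N) := fun x => by
    rw [hδ, pow_add]
    exact Submodule.mul_mem_mul (copies_mem M K x)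
      (Submodule.pow_mem_pow _ (Submodule.subset_span (by simp)) δ)
  choose A hA using fun x => exists_coeffs hN J (hmem x)
  have hA' : ∀ g, Matrix.of A *ᵥ copies N J g = entry 0 0 g ^ δ • copies M K g := fun g => by
    funext x
    rw [Pi.smul_apply, smul_eq_mul, mul_comm]
    exact (hA x g).symm
  obtain ⟨r, 𝓜, hr, h𝓜⟩ := exists_operation (Matrix.of A)
  have hout : ∀ g, 𝓜.toMap (pureState (copies N J g)) =
      ((r * Complex.normSq (entry 0 0 g ^ δ) : ℝ) : ℂ) • pureState (copies M K g) := fun g => by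
    rw [h𝓜, conj_pureState, hA', pureState, star_smul, Matrix.smul_vecMulVec,
      Matrix.vecMulVec_smul, smul_smul, smul_smul, Complex.ofReal_mul, Complex.star_def, mul_assoc,
      Complex.mul_conj, pureState]
  have hs : ∀ g, successProbAt 𝓜 g = r * Complex.normSq (entry 0 0 g ^ δ) := fun g => by
    rw [successProbAt, hout, Matrix.trace_smul, trace_pureState, star_copies_dotProduct_self,
      smul_eq_mul, mul_one, Complex.ofReal_re]
  have ho : ∀ g, overlapAt 𝓜 g = successProbAt 𝓜 g := fun g => by
    rw [hs, overlapAt, hout, Matrix.smul_mulVec, dotProduct_smul, pureState,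
      Matrix.vecMulVec_mulVec, star_copies_dotProduct_self, MulOpposite.op_one,
      one_smul, star_copies_dotProduct_self, smul_eq_mul, mul_one, Complex.ofReal_re]
  have hpos : 0 < successProb 𝓜 := by
    refine lt_of_le_of_ne (integral_nonneg (successProbAt_nonneg 𝓜)) fun h0 => ?_
    -- At the identity `a = 1`, so the success probability there is `r > 0`.
    have h1 := eq_zero_of_integral_eq_zero (continuous_successProbAt 𝓜) (successProbAt_nonneg 𝓜)
      h0.symm 1
    rw [hs] at h1
    simp [entry, hr.ne'] at h1
  refine ⟨𝓜, hpos, ?_⟩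
  rw [fidelity, div_eq_one_iff_eq hpos.ne', successProb]
  exact integral_congr_ae (Filter.Eventually.of_forall ho)

end BellConversion
end

open BellConversion
theorem theorem2 (N M : ℕ) (J K : Spin) (hN : 1 < N) :
    (∃ 𝓜 : QuantumOperation (Pairs N J) (Pairs M K), PerfectlyConverts 𝓜) ↔
      (M : ℝ) * K.val ≤ (N : ℝ) * J.val := by
  have h : (M : ℝ) * K.val ≤ (N : ℝ) * J.val ↔ K.twice * M ≤ J.twice * N := by
    rw [← Nat.cast_le (α := ℝ), Spin.val, Spin.val]
    push_cast
    constructor <;> intro h <;> linarith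
  rw [h]
  exact ⟨fun ⟨_, h𝓜⟩ => le_of_perfectlyConverts h𝓜, exists_perfectlyConverts hN⟩
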